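/- For $n\ge 0$ let $\mathscr I_n=\{\sigma\in S_n:\sigma^2=\mathrm{id}\}$ be the set of involutions of the symmetric group $S_n$ (the identity included), and for $\sigma\in S_n$ let $\mathrm{ris}(\sigma)$ be the number of indices $1\le i\le n-1$ with $\sigma(i)<\sigma(i+1)$. Let $$F_n(t)=\sum_{\sigma\in\mathscr I_n}\mathrm{sgn}(\sigma)\,t^{\mathrm{ris}(\sigma)}\in\mathbb Z[t]$$ be the $n$-th signed Eulerian polynomial on involutions (so $F_0(t)=1$). Then, in the ring $\mathbb Z[[t,u]]$ of formal power series in two variables, both of the following series converge coefficientwise (with $\mathbb Z$ discrete), and $$\sum_{n\ge 0}F_n(t)\frac{u^n}{(1-t)^{n+1}}=\sum_{m\ge 0}t^m\frac{(1+u)^{m+1}}{(1+u^2)^{\binom{m+2}{2}}}.$$ -/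

import Mathlib

open scoped MvPowerSeries.WithPiTopology

namespace SignedEulerian

/-- The number of rises of a permutation `σ` of an `n`-element chain: the number of positions `i`
such that `i + 1` is also a position and `σ i < σ (i + 1)`. -/
def ris {n : ℕ} (σ : Equiv.Perm (Fin n)) : ℕ :=
  (Finset.univ.filter fun i : Fin n => ∃ h : (i : ℕ) + 1 < n, σ i < σ ⟨(i : ℕ) + 1, h⟩).card

/-- The set `𝓘ₙ` of involutions in `Sₙ` (the identity included). -/
def involutions (n : ℕ) : Finset (Equiv.Perm (Fin n)) :=
  Finset.univ.filter fun σ => σ * σ = 1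

/-- The signed Eulerian polynomial on involutions, `Fₙ(t) = ∑_{σ ∈ 𝓘ₙ} sgn(σ) t ^ ris(σ)`. -/
noncomputable def F (n : ℕ) : Polynomial ℤ :=
  ∑ σ ∈ involutions n,
    Polynomial.C ((Equiv.Perm.sign σ : ℤˣ) : ℤ) * Polynomial.X ^ ris σ

/-- The ring `ℤ⟦t, u⟧` of formal power series in two variables. The topology on it is that of
coefficientwise convergence, where `ℤ` is discrete. -/
abbrev Series : Type := MvPowerSeries (Fin 2) ℤ

/-- The variable `t`. -/
noncomputable abbrev t : Series := MvPowerSeries.X 0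

/-- The variable `u`. -/
noncomputable abbrev u : Series := MvPowerSeries.X 1

/-- The `n`-th term `Fₙ(t) uⁿ / (1 - t) ^ (n + 1)` of the left-hand series;
`1 - t` is a unit of `ℤ⟦t, u⟧`. -/
noncomputable def lhsTerm (n : ℕ) : Series :=
  Polynomial.aeval t (F n) * u ^ n * Ring.inverse ((1 - t) ^ (n + 1))

/-- The `m`-th term `tᵐ (1 + u) ^ (m + 1) / (1 + u²) ^ ((m + 2).choose 2)` of the right-hand
series; `1 + u²` is a unit of `ℤ⟦t, u⟧`. -/
noncomputable def rhsTerm (m : ℕ) : Series :=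
  t ^ m * (1 + u) ^ (m + 1) * Ring.inverse ((1 + u ^ 2) ^ ((m + 2).choose 2))

end SignedEulerian

/-! Fix `m`, `n` and put `N = m + 1`. On the left, the coefficient of `t ^ m * u ^ n` is the sum of
`sgn σ * (n + m - ris σ).choose n` over involutions with `ris σ ≤ m`. The binomial counts the
sequences `a : Fin n → Fin N` compatible with `σ` (`card_isCompatible`), so the coefficient is a
signed count of pairs `(σ, a)`. Sending `(σ, a)` to the multiset of all `(a i, a (σ i))` is a
bijection onto the swap-invariant multisets of size `n` (`pairs_injective`, `exists_pairs_eq`). Such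
a multiset is a set `S` of values (fixed points) together with a multiset `M` of unordered pairs
(2-cycles), and the sign is `(-1) ^ card M`. With `card M = k` there are `N.choose (n - 2k)` choices
of `S` and `((N + 1).choose 2).multichoose k` of `M`; the signed sum is the coefficient of `u ^ n`
in `(1 + u) ^ N / (1 + u²) ^ ((N + 1).choose 2)`. -/

namespace SignedEulerian

/-! ### Coefficients of the two series -/

/-- A power series in one variable, regarded as a power series in the `i`-th of two variables. -/
noncomputable def inVar (i : Fin 2) : PowerSeries ℤ →ₐ[ℤ] Series :=
  MvPowerSeries.rename (Function.Embedding.punit (β := Fin 2) i)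

theorem inVar_X (i : Fin 2) : inVar i PowerSeries.X = MvPowerSeries.X i :=
  MvPowerSeries.rename_X _ _

theorem coeff_inVar_single (i : Fin 2) (f : PowerSeries ℤ) (k : ℕ) :
    MvPowerSeries.coeff (Finsupp.single i k) (inVar i f) = PowerSeries.coeff k f := by
  have h := MvPowerSeries.coeff_embDomain_rename (R := ℤ)
    (Function.Embedding.punit (β := Fin 2) i) f (Finsupp.single PUnit.unit k)
  rw [Finsupp.embDomain_single] at h
  exact h

theorem coeff_inVar_eq_zero {i j : Fin 2} (hij : j ≠ i) (f : PowerSeries ℤ) {d : Fin 2 →₀ ℕ}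
    (hd : d j ≠ 0) : MvPowerSeries.coeff d (inVar i f) = 0 := by
  refine MvPowerSeries.coeff_rename_eq_zero _ _ ?_
  rintro ⟨x, rfl⟩
  apply hd
  rw [Finsupp.mapDomain_of_notMem_range]
  rintro ⟨_, h⟩
  exact hij h.symm

/-- Every term on either side splits into a series in `t` times a series in `u`, one factor being a
pure power; hence each coefficient of either sum comes from a single term. -/
theorem coeff_inVar_mul_inVar (f g : PowerSeries ℤ) (d : Fin 2 →₀ ℕ) :
    MvPowerSeries.coeff d (inVar 0 f * inVar 1 g) =
      PowerSeries.coeff (d 0) f * PowerSeries.coeff (d 1) g := by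
  classical
  rw [MvPowerSeries.coeff_mul,
    Finset.sum_eq_single (Finsupp.single 0 (d 0), Finsupp.single 1 (d 1))]
  · rw [coeff_inVar_single, coeff_inVar_single]
  · rintro ⟨a, b⟩ hab hne
    rw [Finset.HasAntidiagonal.mem_antidiagonal] at hab
    dsimp only at hab ⊢
    by_cases ha : a 1 = 0
    · by_cases hb : b 0 = 0
      · refine absurd ?_ hne
        subst hab
        ext i <;> fin_cases i <;> simp [ha, hb]
      · rw [coeff_inVar_eq_zero (i := 1) (j := 0) (by decide) _ hb, mul_zero]
    · rw [coeff_inVar_eq_zero (i := 0) (j := 1) (by decide) _ ha, zero_mul]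
  · intro h
    refine absurd ?_ h
    rw [Finset.HasAntidiagonal.mem_antidiagonal]
    ext i
    fin_cases i <;> simp

theorem inVar_inverse_eq {i : Fin 2} {f g : PowerSeries ℤ} (h : f * g = 1) :
    Ring.inverse (inVar i f) = inVar i g := by
  have h' : inVar i f * inVar i g = 1 := by rw [← map_mul, h, map_one]
  exact Ring.inverse_unit (Units.mkOfMulEqOne _ _ h')

theorem aeval_t_eq_inVar (p : Polynomial ℤ) :
    Polynomial.aeval t p = inVar 0 (p : PowerSeries ℤ) := by
  have : Polynomial.aeval t = (inVar 0).comp (Polynomial.coeToPowerSeries.algHom (A := ℤ)) := by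
    ext
    simp [inVar_X, Polynomial.coeToPowerSeries.algHom_apply]
  rw [this]
  simp [Polynomial.coeToPowerSeries.algHom_apply]

theorem lhsTerm_eq (n : ℕ) :
    lhsTerm n = inVar 0 ((F n : PowerSeries ℤ) *
      PowerSeries.mk fun k => ((n + k).choose n : ℤ)) * inVar 1 (PowerSeries.X ^ n) := by
  have h : (1 - t) ^ (n + 1) = inVar 0 ((1 - PowerSeries.X) ^ (n + 1)) := by
    rw [map_pow, map_sub, map_one, inVar_X]
  rw [lhsTerm, h, inVar_inverse_eq
    ((mul_comm _ _).trans (PowerSeries.mk_add_choose_mul_one_sub_pow_eq_one ℤ n)),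
    aeval_t_eq_inVar, map_mul, map_pow, inVar_X]
  ring

/-- The coefficients of `1 / (1 + X ^ 2) ^ K`. -/
def altMultichoose (K j : ℕ) : ℤ :=
  if Even j then (-1) ^ (j / 2) * (K.multichoose (j / 2) : ℤ) else 0

theorem one_add_X_sq_mul_mk_altMultichoose_succ (K : ℕ) :
    (1 + PowerSeries.X ^ 2 : PowerSeries ℤ) * PowerSeries.mk (altMultichoose (K + 1)) =
      PowerSeries.mk (altMultichoose K) := by
  ext j
  rw [add_mul, one_mul, map_add, PowerSeries.coeff_X_pow_mul', PowerSeries.coeff_mk,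
    PowerSeries.coeff_mk, PowerSeries.coeff_mk]
  rcases j with _ | _ | j
  · simp [altMultichoose]
  · simp [altMultichoose]
  · have h : (j + 1 + 1) / 2 = j / 2 + 1 := by omega
    have he : Even (j + 1 + 1) ↔ Even j := by grind
    simp only [altMultichoose, h, he, Nat.multichoose_succ_succ]
    by_cases hj : Even j <;> simp [hj, pow_succ]
    ring

theorem one_add_X_sq_pow_mul_mk_altMultichoose (K : ℕ) :
    (1 + PowerSeries.X ^ 2 : PowerSeries ℤ) ^ K * PowerSeries.mk (altMultichoose K) = 1 := by
  induction K with
  | zero =>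
    ext j
    rw [pow_zero, one_mul, PowerSeries.coeff_mk, PowerSeries.coeff_one]
    rcases j with _ | _ | j
    · simp [altMultichoose]
    · simp [altMultichoose]
    · have h : (j + 1 + 1) / 2 = j / 2 + 1 := by omega
      simp [altMultichoose, h]
  | succ K ih => rw [pow_succ, mul_assoc, one_add_X_sq_mul_mk_altMultichoose_succ, ih]

theorem rhsTerm_eq (m : ℕ) :
    rhsTerm m = inVar 0 (PowerSeries.X ^ m) * inVar 1 ((1 + PowerSeries.X) ^ (m + 1) *
      PowerSeries.mk (altMultichoose ((m + 2).choose 2))) := by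
  have h : (1 + u ^ 2) ^ ((m + 2).choose 2) =
      inVar 1 ((1 + PowerSeries.X ^ 2) ^ ((m + 2).choose 2)) := by
    rw [map_pow, map_add, map_one, map_pow, inVar_X]
  rw [rhsTerm, h, inVar_inverse_eq (one_add_X_sq_pow_mul_mk_altMultichoose _),
    map_mul, map_pow, map_pow, map_add, map_one, inVar_X, inVar_X]
  ring

theorem coeff_F_mul_mk_choose (n m : ℕ) :
    PowerSeries.coeff m ((F n : PowerSeries ℤ) *
      PowerSeries.mk fun k => ((n + k).choose n : ℤ)) =
    ∑ σ ∈ involutions n, ((Equiv.Perm.sign σ : ℤˣ) : ℤ) *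
      if ris σ ≤ m then ((n + (m - ris σ)).choose n : ℤ) else 0 := by
  have : (F n : PowerSeries ℤ) = ∑ σ ∈ involutions n,
      PowerSeries.C ((Equiv.Perm.sign σ : ℤˣ) : ℤ) * PowerSeries.X ^ ris σ := by
    rw [F, ← Polynomial.coeToPowerSeries.ringHom_apply, map_sum]
    refine Finset.sum_congr rfl fun σ _ => ?_
    rw [Polynomial.coeToPowerSeries.ringHom_apply, Polynomial.coe_mul, Polynomial.coe_C,
      Polynomial.coe_pow, Polynomial.coe_X]
  rw [this, Finset.sum_mul, map_sum]
  refine Finset.sum_congr rfl fun σ _ => ?_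
  rw [mul_assoc, PowerSeries.coeff_C_mul, PowerSeries.coeff_X_pow_mul', PowerSeries.coeff_mk]

theorem coeff_one_add_X_pow_mul_mk_altMultichoose (N K n : ℕ) :
    PowerSeries.coeff n ((1 + PowerSeries.X) ^ N * PowerSeries.mk (altMultichoose K)) =
    ∑ k ∈ Finset.range (n / 2 + 1),
      (-1) ^ k * ((N.choose (n - 2 * k) * K.multichoose k : ℕ) : ℤ) := by
  have h1 (j : ℕ) : PowerSeries.coeff j ((1 + PowerSeries.X : PowerSeries ℤ) ^ N) = N.choose j := by
    have := Polynomial.coeff_one_add_X_pow ℤ N j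
    rw [← this, ← Polynomial.coeff_coe]
    simp
  rw [PowerSeries.coeff_mul, ← Finset.Nat.sum_antidiagonal_swap,
    Finset.Nat.sum_antidiagonal_eq_sum_range_succ_mk]
  simp only [Prod.swap, h1, PowerSeries.coeff_mk]
  symm
  refine Finset.sum_of_injOn (fun k => 2 * k) (fun a _ b _ h => by simpa using h) ?_ ?_ ?_
  · intro k hk
    simp at hk ⊢
    omega
  · intro j hj hj'
    have : ¬ Even j := by
      rintro ⟨k, rfl⟩
      refine hj' ⟨k, ?_, by simp; omega⟩
      simp at hj ⊢
      omega
    simp [altMultichoose, this]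
  · intro k _
    simp [altMultichoose]
    ring

theorem hasSum_lhsTerm {G : Series}
    (hG : ∀ d, MvPowerSeries.coeff d G = ∑ σ ∈ involutions (d 1), ((Equiv.Perm.sign σ : ℤˣ) : ℤ) *
      if ris σ ≤ d 0 then ((d 1 + (d 0 - ris σ)).choose (d 1) : ℤ) else 0) :
    HasSum lhsTerm G := by
  rw [MvPowerSeries.WithPiTopology.hasSum_iff_hasSum_coeff]
  intro d
  rw [hG, ← coeff_F_mul_mk_choose]
  convert hasSum_single (d 1) fun n hn => ?_ using 1
  · rw [lhsTerm_eq, coeff_inVar_mul_inVar, PowerSeries.coeff_X_pow_self, mul_one]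
  · rw [lhsTerm_eq, coeff_inVar_mul_inVar, PowerSeries.coeff_X_pow, if_neg hn.symm, mul_zero]

theorem hasSum_rhsTerm {G : Series}
    (hG : ∀ d, MvPowerSeries.coeff d G = ∑ k ∈ Finset.range (d 1 / 2 + 1), (-1) ^ k *
      (((d 0 + 1).choose (d 1 - 2 * k) * ((d 0 + 2).choose 2).multichoose k : ℕ) : ℤ)) :
    HasSum rhsTerm G := by
  rw [MvPowerSeries.WithPiTopology.hasSum_iff_hasSum_coeff]
  intro d
  rw [hG, ← coeff_one_add_X_pow_mul_mk_altMultichoose]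
  convert hasSum_single (d 0) fun m hm => ?_ using 1
  · rw [rhsTerm_eq, coeff_inVar_mul_inVar, PowerSeries.coeff_X_pow_self, one_mul]
  · rw [rhsTerm_eq, coeff_inVar_mul_inVar, PowerSeries.coeff_X_pow, if_neg hm.symm, zero_mul]

/-! ### Sequences with prescribed gaps and compatible sequences -/

/-- Subtracting the forced growth `E i` and adding `i` makes the sequence strictly increasing, so it
becomes a `(k + 1)`-subset of `range (k + 1 + (m - E k))`. The bound `E i ≤ a i` keeps the natural
subtraction exact. -/
theorem card_filter_gap_le (k m : ℕ) (e : ℕ → ℕ) :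
    (Finset.univ.filter fun a : Fin (k + 1) → Fin (m + 1) =>
      ∀ i : Fin k, (a i.castSucc : ℕ) + e i ≤ a i.succ).card =
    if ∑ j ∈ Finset.range k, e j ≤ m then
      (k + 1 + (m - ∑ j ∈ Finset.range k, e j)).choose (k + 1) else 0 := by
  set E : ℕ → ℕ := fun i => ∑ j ∈ Finset.range i, e j with hE
  have hE0 : E 0 = 0 := by simp [hE]
  have hEs (i : ℕ) : E (i + 1) = E i + e i := Finset.sum_range_succ _ _
  change _ = if E k ≤ m then (k + 1 + (m - E k)).choose (k + 1) else 0
  have hlow {a : Fin (k + 1) → Fin (m + 1)}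
      (ha : ∀ i : Fin k, (a i.castSucc : ℕ) + e i ≤ a i.succ) (i : Fin (k + 1)) :
      E i ≤ a i := by
    induction i using Fin.induction with
    | zero => simp [hE0]
    | succ i ih =>
      have := ha i
      have := hEs i
      simp only [Fin.val_castSucc, Fin.val_succ] at *
      omega
  have hhigh {a : Fin (k + 1) → Fin (m + 1)}
      (ha : ∀ i : Fin k, (a i.castSucc : ℕ) + e i ≤ a i.succ) (i : Fin (k + 1)) :
      a i + E k ≤ m + E i := by
    induction i using Fin.reverseInduction with
    | last =>
      have := (a (Fin.last k)).isLt
      simp only [Fin.val_last]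
      omega
    | cast i ih =>
      have := ha i
      have := hEs i
      simp only [Fin.val_castSucc, Fin.val_succ] at *
      omega
  split_ifs with hm
  · rw [← Finset.card_range (k + 1 + (m - E k)), ← Finset.card_powersetCard]
    have hmono {a : Fin (k + 1) → Fin (m + 1)}
        (ha : ∀ i : Fin k, (a i.castSucc : ℕ) + e i ≤ a i.succ) :
        StrictMono fun i => (a i : ℕ) - E i + i := by
      rw [Fin.strictMono_iff_lt_succ]
      intro i
      have := ha i
      have := hEs i
      have := hlow ha i.castSucc
      have := hlow ha i.succ
      simp only [Fin.val_castSucc, Fin.val_succ] at *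
      omega
    refine Finset.card_bij
      (fun a _ => Finset.univ.image fun i : Fin (k + 1) => (a i : ℕ) - E i + i) ?_ ?_ ?_
    · intro a ha
      rw [Finset.mem_filter] at ha
      rw [Finset.mem_powersetCard, Finset.card_image_of_injective _ (hmono ha.2).injective]
      refine ⟨fun x hx => ?_, by simp⟩
      obtain ⟨i, -, rfl⟩ := Finset.mem_image.1 hx
      have := hhigh ha.2 i
      rw [Finset.mem_range]
      omega
    · intro a ha b hb hab
      rw [Finset.mem_filter] at ha hb
      have h := ((hmono ha.2).range_inj (hmono hb.2)).1
        (by simpa using congrArg (fun s : Finset ℕ => (s : Set ℕ)) hab)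
      ext i
      have h1 := congrFun h i
      have := hlow ha.2 i
      have := hlow hb.2 i
      omega
    · intro s hs
      rw [Finset.mem_powersetCard] at hs
      set c := s.orderEmbOfFin hs.2
      have hc (i : Fin k) : c i.castSucc < c i.succ := c.strictMono i.castSucc_lt_succ
      have hc1 (i : Fin (k + 1)) : (i : ℕ) ≤ c i := by
        induction i using Fin.induction with
        | zero => simp
        | succ i ih =>
          have := hc i
          simp only [Fin.val_castSucc, Fin.val_succ] at *
          omega
      have hc2 (i : Fin (k + 1)) : c i + E k ≤ m + i := by
        induction i using Fin.reverseInduction with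
        | last =>
          have := Finset.mem_range.1 (hs.1 (s.orderEmbOfFin_mem hs.2 (Fin.last k)))
          change c _ < _ at this
          simp only [Fin.val_last]
          omega
        | cast i ih =>
          have := hc i
          simp only [Fin.val_castSucc, Fin.val_succ] at *
          omega
      have hEk (i : Fin (k + 1)) : E i ≤ E k :=
        Finset.sum_le_sum_of_subset (Finset.range_mono (Nat.le_of_lt_succ i.isLt))
      refine ⟨fun i => ⟨c i - i + E i, ?_⟩, ?_, ?_⟩
      · have := hc1 i
        have := hc2 i
        have := hEk i
        omega
      · rw [Finset.mem_filter]
        refine ⟨Finset.mem_univ _, fun i => ?_⟩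
        have := hc i
        have := hc1 i.castSucc
        have := hEs i
        simp only [Fin.val_castSucc, Fin.val_succ] at *
        omega
      · have : ∀ i : Fin (k + 1), c i - i + E i - E i + i = c i := fun i => by
          have := hc1 i
          omega
        simp only [this]
        exact s.image_orderEmbOfFin_univ hs.2
  · rw [Finset.card_eq_zero, Finset.filter_eq_empty_iff]
    intro a _ ha
    have := hlow ha (Fin.last k)
    have := (a (Fin.last k)).isLt
    simp only [Fin.val_last] at *
    omega

/-- A sequence `a` is compatible with `σ` if it is weakly increasing, and strictly increasing at the
rises of `σ`. -/
def IsCompatible {n N : ℕ} (σ : Equiv.Perm (Fin n)) (a : Fin n → Fin N) : Prop :=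
  StrictMono fun i => toLex (a i, OrderDual.toDual (σ i))

noncomputable instance {n N : ℕ} (σ : Equiv.Perm (Fin n)) (a : Fin n → Fin N) :
    Decidable (IsCompatible σ a) :=
  Classical.propDecidable _

theorem isCompatible_iff {n N : ℕ} {σ : Equiv.Perm (Fin n)} {a : Fin n → Fin N} :
    IsCompatible σ a ↔ ∀ i j, i < j → a i ≤ a j ∧ (a i = a j → σ j < σ i) := by
  simp only [IsCompatible, StrictMono, Prod.Lex.toLex_lt_toLex', OrderDual.toDual_lt_toDual]

theorem ris_succ {k : ℕ} (σ : Equiv.Perm (Fin (k + 1))) :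
    ris σ = ∑ i : Fin k, if σ i.castSucc < σ i.succ then 1 else 0 := by
  rw [ris, Finset.card_filter, Fin.sum_univ_castSucc]
  have h : ¬ ∃ h : (Fin.last k : ℕ) + 1 < k + 1, σ (Fin.last k) < σ ⟨(Fin.last k : ℕ) + 1, h⟩ := by
    rintro ⟨h, -⟩
    simp at h
  rw [if_neg h, add_zero]
  refine Finset.sum_congr rfl fun i _ => if_congr ?_ rfl rfl
  constructor
  · rintro ⟨_, h⟩
    exact h
  · exact fun h => ⟨by simp, h⟩

theorem card_isCompatible {n : ℕ} (σ : Equiv.Perm (Fin n)) (m : ℕ) :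
    (Finset.univ.filter fun a : Fin n → Fin (m + 1) => IsCompatible σ a).card =
      if ris σ ≤ m then (n + (m - ris σ)).choose n else 0 := by
  rcases n with _ | k
  · have h0 : ris σ = 0 := by simp [ris]
    have (a : Fin 0 → Fin (m + 1)) : IsCompatible σ a := fun i => i.elim0
    simp [h0, this]
  -- Consecutive positions need gap 1 at a rise and 0 elsewhere, so the gaps add up to `ris σ`.
  · have key := card_filter_gap_le k m fun i => if h : i < k then
      if σ (Fin.castSucc ⟨i, h⟩) < σ (Fin.succ ⟨i, h⟩) then 1 else 0 else 0
    rw [Finset.sum_range] at key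
    simp only [Fin.is_lt, dite_true, Fin.eta, ← ris_succ] at key
    rw [← key]
    congr 1
    refine Finset.filter_congr fun a _ => ?_
    rw [IsCompatible, Fin.strictMono_iff_lt_succ]
    refine forall_congr' fun i => ?_
    have hne : σ i.castSucc ≠ σ i.succ := σ.injective.ne i.castSucc_lt_succ.ne
    rw [Prod.Lex.toLex_lt_toLex', OrderDual.toDual_lt_toDual]
    dsimp only
    split_ifs with h
    · grind
    · grind

/-! ### Sorted enumerations and the sign of an involution -/

theorem eq_of_monotone_of_map_univ_eq {n : ℕ} {α : Type*} [PartialOrder α] {f g : Fin n → α}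
    (hf : Monotone f) (hg : Monotone g)
    (h : Finset.univ.val.map f = Finset.univ.val.map g) : f = g := by
  rw [Fin.univ_val_map, Fin.univ_val_map, Multiset.coe_eq_coe] at h
  exact List.ofFn_injective (h.eq_of_pairwise' hf.sortedLE_ofFn.pairwise hg.sortedLE_ofFn.pairwise)

theorem exists_monotone_map_univ_eq {n : ℕ} {α : Type*} [LinearOrder α] (P : Multiset α)
    (hP : P.card = n) : ∃ f : Fin n → α, Monotone f ∧ Finset.univ.val.map f = P := by
  subst hP
  have hlen : (P.sort (· ≤ ·)).length = P.card := Multiset.length_sort _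
  refine ⟨fun i => (P.sort (· ≤ ·)).get (i.cast hlen.symm), ?_, ?_⟩
  · intro i j hij
    exact (Multiset.pairwise_sort P (· ≤ ·)).rel_get_of_le (by simpa using hij)
  · rw [Fin.univ_val_map]
    conv_rhs => rw [← Multiset.sort_eq P (· ≤ ·)]
    congr 1
    apply List.ext_get
    · simp
    · intro i h1 h2
      simp

theorem perm_eq_one_of_strictMono {n : ℕ} {τ : Equiv.Perm (Fin n)} (h : StrictMono τ) : τ = 1 := by
  have := Subsingleton.elim (h.orderIsoOfSurjective _ τ.surjective) (OrderIso.refl (Fin n))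
  ext i
  exact congrArg Fin.val (DFunLike.congr_fun this i)

/-- All nontrivial cycles are transpositions, and each contains exactly one `i` with `i < σ i`. -/
theorem sign_eq_neg_one_pow_card {n : ℕ} {σ : Equiv.Perm (Fin n)} (hσ : σ * σ = 1) :
    Equiv.Perm.sign σ = (-1) ^ (Finset.univ.filter fun i => i < σ i).card := by
  have hinv (i : Fin n) : σ (σ i) = i := DFunLike.congr_fun hσ i
  have h2 : σ.support.card = 2 * (Finset.univ.filter fun i => i < σ i).card := by
    have h1 : σ.support = (Finset.univ.filter fun i => i < σ i) ∪
        (Finset.univ.filter fun i => σ i < i) := by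
      ext i
      simp only [Equiv.Perm.mem_support, Finset.mem_union, Finset.mem_filter, Finset.mem_univ,
        true_and]
      exact ne_iff_lt_or_gt.trans or_comm
    have h3 : (Finset.univ.filter fun i => σ i < i).card =
        (Finset.univ.filter fun i => i < σ i).card :=
      Finset.card_bij (fun i _ => σ i) (by simp [hinv]) (by simp)
        fun i hi => ⟨σ i, by simpa [hinv] using hi, hinv i⟩
    rw [h1, Finset.card_union_of_disjoint, h3, two_mul]
    exact Finset.disjoint_filter.2 fun i _ h h' => lt_asymm h h'
  have hc : ∀ x ∈ σ.cycleType, x = 2 := by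
    intro x hx
    have h4 : x ∣ 2 := (Equiv.Perm.dvd_of_mem_cycleType hx).trans
      (orderOf_dvd_of_pow_eq_one (by rw [pow_two, hσ]))
    exact le_antisymm (Nat.le_of_dvd two_pos h4) (Equiv.Perm.two_le_of_mem_cycleType hx)
  have hs := σ.sum_cycleType
  rw [Multiset.eq_replicate_of_mem hc, Multiset.sum_replicate, h2, smul_eq_mul, mul_comm] at hs
  rw [Equiv.Perm.sign_of_cycleType, σ.sum_cycleType, h2, pow_add, pow_mul]
  rw [← Nat.eq_of_mul_eq_mul_left two_pos hs]
  simp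

/-! ### Symmetric multisets of pairs -/

/-- The two orientations of an unordered pair. -/
def orientations {α : Type*} : Sym2 α → Multiset (α × α) :=
  Sym2.lift ⟨fun p q => {(p, q), (q, p)}, fun _ _ => Multiset.cons_swap _ _ _⟩

@[simp]
theorem orientations_mk {α : Type*} (p q : α) : orientations s(p, q) = {(p, q), (q, p)} := rfl

/-- The symmetric multiset of pairs whose odd diagonal entries are given by `S`, and whose remaining
pairs are given by `M`. -/
def symmetrize {α : Type*} (S : Finset α) (M : Multiset (Sym2 α)) : Multiset (α × α) :=
  S.val.map (fun x => (x, x)) + M.bind orientations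

theorem card_symmetrize {α : Type*} (S : Finset α) (M : Multiset (Sym2 α)) :
    (symmetrize S M).card = S.card + 2 * M.card := by
  have h (z : Sym2 α) : (orientations z).card = 2 := by
    induction z with | _ => rfl
  simp [symmetrize, Multiset.card_bind, h, mul_comm]

theorem map_swap_symmetrize {α : Type*} (S : Finset α) (M : Multiset (Sym2 α)) :
    (symmetrize S M).map Prod.swap = symmetrize S M := by
  have h (z : Sym2 α) : (orientations z).map Prod.swap = orientations z := by
    induction z with
    | _ p q =>
      simp only [orientations_mk, Multiset.insert_eq_cons, Multiset.map_cons, Multiset.map_singleton,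
        Prod.swap_prod_mk]
      exact Multiset.cons_swap _ _ _
  simp [symmetrize, Multiset.map_bind, h]

theorem count_bind_orientations {α : Type*} [DecidableEq α] (M : Multiset (Sym2 α)) (p q : α) :
    (M.bind orientations).count (p, q) = (if p = q then 2 else 1) * M.count s(p, q) := by
  induction M using Multiset.induction_on with
  | empty => simp
  | cons z M ih =>
    induction z with
    | _ x y =>
      rw [Multiset.cons_bind, Multiset.count_add, ih, Multiset.count_cons, orientations_mk,
        Multiset.insert_eq_cons, Multiset.count_cons, Multiset.count_singleton]
      simp only [Prod.mk.injEq, Sym2.eq_iff]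
      grind

/-- A loop `s(p, p)` contributes `(p, p)` twice, so the parity of the multiplicity of `(p, p)`
recovers `S`; the multiplicities then recover `M`. -/
theorem symmetrize_injective {α : Type*} {S S' : Finset α} {M M' : Multiset (Sym2 α)}
    (h : symmetrize S M = symmetrize S' M') : S = S' ∧ M = M' := by
  classical
  have hd (S : Finset α) (p q : α) :
      (S.val.map fun x => (x, x)).count (p, q) = if p = q ∧ p ∈ S then 1 else 0 := by
    by_cases hpq : p = q
    · subst hpq
      rw [Multiset.count_map_eq_count' (fun x : α => (x, x)) _ (fun x y h => (Prod.ext_iff.1 h).1),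
        Multiset.count_eq_of_nodup S.nodup]
      simp
    · rw [if_neg (fun h => hpq h.1), Multiset.count_eq_zero]
      simp only [Multiset.mem_map, not_exists, not_and, Prod.mk.injEq]
      rintro x - rfl
      exact hpq
  have hc (p q : α) := congrArg (Multiset.count (p, q)) h
  simp only [symmetrize, Multiset.count_add, hd, count_bind_orientations] at hc
  constructor
  · ext p
    have := hc p p
    simp only [true_and, if_true] at this
    split_ifs at this <;> first | omega | tauto
  · ext z
    induction z with
    | _ p q =>
      have := hc p q
      split_ifs at this <;> first | omega | tauto

/-! ### Compatible pairs and symmetric multisets -/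

variable {n N : ℕ} {σ σ' : Equiv.Perm (Fin n)} {a : Fin n → Fin N}

theorem IsCompatible.monotone (h : IsCompatible σ a) : Monotone a := by
  rw [isCompatible_iff] at h
  exact monotone_iff_forall_lt.2 fun i j hij => (h i j hij).1

theorem IsCompatible.monotone_pair (h : IsCompatible σ a) :
    Monotone fun i => toLex (a i, OrderDual.toDual (a (σ i))) := by
  refine monotone_iff_forall_lt.2 fun i j hij => ?_
  rw [Prod.Lex.toLex_le_toLex', OrderDual.toDual_le_toDual]
  have h' := isCompatible_iff.1 h i j hij
  exact ⟨h'.1, fun he => h.monotone (h'.2 he).le⟩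

/-- The multiset of pairs `(a i, a (σ i))`. -/
def pairs (σ : Equiv.Perm (Fin n)) (a : Fin n → Fin N) : Multiset (Fin N × Fin N) :=
  Finset.univ.val.map fun i => (a i, a (σ i))

/-- The values of `a` at the fixed points of `σ`. -/
def fixedValues (σ : Equiv.Perm (Fin n)) (a : Fin n → Fin N) : Finset (Fin N) :=
  (Finset.univ.filter fun i => σ i = i).image a

/-- The pairs of values of `a` at the transposed pairs of the involution `σ`. -/
def cycleValues (σ : Equiv.Perm (Fin n)) (a : Fin n → Fin N) : Multiset (Sym2 (Fin N)) :=
  (Finset.univ.filter fun i => i < σ i).val.map fun i => s(a i, a (σ i))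

theorem symmetrize_fixedValues_cycleValues (hσ : σ * σ = 1) (h : IsCompatible σ a) :
    symmetrize (fixedValues σ a) (cycleValues σ a) = pairs σ a := by
  have hinv (i : Fin n) : σ (σ i) = i := DFunLike.congr_fun hσ i
  -- Where `a` is constant `σ` is decreasing, so it has at most one fixed point there.
  have hinj : Set.InjOn a (Finset.univ.filter fun i => σ i = i : Finset (Fin n)) := by
    intro i hi j hj hij
    simp only [Finset.coe_filter, Finset.mem_univ, true_and, Set.mem_ofPred_eq] at hi hj
    rw [isCompatible_iff] at h
    rcases lt_trichotomy i j with hlt | heq | hlt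
    · have := (h i j hlt).2 hij
      rw [hi, hj] at this
      exact absurd this hlt.asymm
    · exact heq
    · have := (h j i hlt).2 hij.symm
      rw [hi, hj] at this
      exact absurd this hlt.asymm
  have hsum {α : Type} (s : Finset (Fin n)) (f : Fin n → α) :
      s.val.map f = ∑ i ∈ s, ({f i} : Multiset α) := by
    exact (Multiset.sum_map_singleton _).symm.trans
      (congrArg Multiset.sum (Multiset.map_map _ _ _))
  have hlt : ∑ i ∈ Finset.univ.filter (fun i => i < σ i), ({(a (σ i), a i)} : Multiset _) =
      ∑ i ∈ Finset.univ.filter (fun i => σ i < i), {(a i, a (σ i))} :=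
    Finset.sum_bij (fun i _ => σ i) (by simp [hinv]) (by simp)
      (fun i hi => ⟨σ i, by simpa [hinv] using hi, hinv i⟩) (by simp [hinv])
  have hbind : (Finset.univ.filter fun i => i < σ i).val.bind
      (fun i => orientations s(a i, a (σ i))) =
      ∑ i ∈ Finset.univ.filter (fun i => i < σ i), ({(a i, a (σ i))} + {(a (σ i), a i)}) := rfl
  have hfix : ∑ i ∈ Finset.univ.filter (fun i => σ i = i), ({(a i, a i)} : Multiset _) =
      ∑ i ∈ Finset.univ.filter (fun i => σ i = i), {(a i, a (σ i))} :=
    Finset.sum_congr rfl fun i hi => by rw [(Finset.mem_filter.1 hi).2]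
  rw [symmetrize, fixedValues, cycleValues, pairs, Finset.image_val_of_injOn hinj,
    Multiset.map_map, Multiset.bind_map, hsum, hsum, hbind, Finset.sum_add_distrib, hlt]
  simp only [Function.comp_apply]
  rw [hfix, Finset.sum_filter, Finset.sum_filter, Finset.sum_filter, ← Finset.sum_add_distrib,
    ← Finset.sum_add_distrib]
  refine Finset.sum_congr rfl fun i _ => ?_
  rcases lt_trichotomy (σ i) i with h1 | h1 | h1
  · simp [h1, h1.ne, h1.not_gt]
  · simp [h1]
  · simp [h1, h1.ne', h1.not_gt]

/-- The product preserves both `a` and `b`. Where both agree, `σ` and then `σ'` each reverse the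
order, so the product is strictly increasing. This serves both for uniqueness of `σ` and, with `σ' =
σ`, for showing that a constructed `σ` is an involution. -/
theorem mul_eq_one_of_isCompatible {b : Fin n → Fin N}
    (h : IsCompatible σ a) (h' : IsCompatible σ' a) (hab : ∀ i, a (σ i) = b i)
    (hab' : ∀ i, a (σ' i) = b i) (hba : ∀ i, b (σ i) = a i) (hba' : ∀ i, b (σ' i) = a i) :
    σ' * σ = 1 := by
  apply perm_eq_one_of_strictMono
  have hm := h.monotone
  rw [isCompatible_iff] at h h'
  have ha (i : Fin n) : a (σ' (σ i)) = a i := by rw [hab', hba]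
  have hb (i : Fin n) : b (σ' (σ i)) = b i := by rw [hba', hab]
  intro i j hij
  simp only [Equiv.Perm.mul_apply]
  rcases (h i j hij).1.lt_or_eq with hlt | heq
  · rw [← ha i, ← ha j] at hlt
    exact hm.reflect_lt hlt
  · have hσ := (h i j hij).2 heq
    rcases (hm hσ.le).lt_or_eq with hlt' | heq'
    · have hne : σ' (σ i) ≠ σ' (σ j) := fun e => hij.ne (σ.injective (σ'.injective e))
      refine hne.lt_or_gt.resolve_right fun hgt => ?_
      have h1 := (h' _ _ hgt).2 (by rw [ha, ha, heq])
      have h2 := hm h1.le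
      rw [hab', hab', hb, hb, ← hab, ← hab] at h2
      exact h2.not_gt hlt'
    · exact (h' _ _ hσ).2 heq'

/-- Compatibility lists the pairs with first entries increasing and, on ties, second entries
decreasing; the multiset thus fixes `a` and `a ∘ σ`. -/
theorem pairs_injective {a' : Fin n → Fin N} (hσ : σ * σ = 1) (hσ' : σ' * σ' = 1)
    (h : IsCompatible σ a) (h' : IsCompatible σ' a') (hp : pairs σ a = pairs σ' a') :
    σ = σ' ∧ a = a' := by
  have hf := eq_of_monotone_of_map_univ_eq h.monotone_pair h'.monotone_pair (by
    simpa [pairs, Function.comp_def] using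
      congrArg (Multiset.map fun x : Fin N × Fin N => toLex (x.1, OrderDual.toDual x.2)) hp)
  have h1 : a = a' := funext fun i => congrArg (fun x => (ofLex x).1) (congrFun hf i)
  subst h1
  have h2 (i : Fin n) : a (σ i) = a (σ' i) :=
    congrArg (fun x => OrderDual.ofDual (ofLex x).2) (congrFun hf i)
  have hinv (i : Fin n) : σ (σ i) = i := DFunLike.congr_fun hσ i
  have hinv' (i : Fin n) : σ' (σ' i) = i := DFunLike.congr_fun hσ' i
  have h3 := mul_eq_one_of_isCompatible (b := fun i => a (σ i)) h h' (fun _ => rfl)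
    (fun i => (h2 i).symm) (fun i => by rw [hinv]) fun i => by rw [h2, hinv']
  exact ⟨by rw [← mul_one σ', ← hσ, ← mul_assoc, h3, one_mul], rfl⟩

theorem exists_pairs_eq (P : Multiset (Fin N × Fin N)) (hP : P.map Prod.swap = P)
    (hn : P.card = n) : ∃ (σ : Equiv.Perm (Fin n)) (a : Fin n → Fin N),
      σ * σ = 1 ∧ IsCompatible σ a ∧ pairs σ a = P := by
  set φ : Fin N × Fin N → Lex (Fin N × (Fin N)ᵒᵈ) := fun x => toLex (x.1, OrderDual.toDual x.2)
  obtain ⟨f, hf, hfP⟩ := exists_monotone_map_univ_eq (P.map φ) (by simpa using hn)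
  set a : Fin n → Fin N := fun i => (ofLex (f i)).1 with ha
  set b : Fin n → Fin N := fun i => OrderDual.ofDual (ofLex (f i)).2 with hb
  have hfab (i : Fin n) : f i = φ (a i, b i) := rfl
  have habP : Finset.univ.val.map (fun i => (a i, b i)) = P := by
    have := congrArg (Multiset.map fun x : Lex (Fin N × (Fin N)ᵒᵈ) =>
      ((ofLex x).1, OrderDual.ofDual (ofLex x).2)) hfP
    simpa [φ, Function.comp_def, ha, hb] using this
  -- Sorting by `key` lists the swapped pairs in the order used for `f`, so swap-invariance gives `a
  -- = b ∘ π` and `b = a ∘ π`. Reversing the index on ties makes `π⁻¹` decreasing on equal pairs, as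
  -- compatibility demands.
  set key : Fin n → Lex (Fin N × Lex ((Fin N)ᵒᵈ × (Fin n)ᵒᵈ)) := fun i =>
    toLex (b i, toLex (OrderDual.toDual (a i), OrderDual.toDual i)) with hkey
  have key_lt {i j : Fin n} : key i < key j ↔
      b i ≤ b j ∧ (b i = b j → a j ≤ a i ∧ (a i = a j → j < i)) := by
    simp [hkey, Prod.Lex.toLex_lt_toLex']
  have hkeyinj : Function.Injective key := fun i j hij => by
    simp only [hkey, EmbeddingLike.apply_eq_iff_eq, Prod.mk.injEq] at hij
    exact hij.2.2
  set π := Tuple.sort key with hπ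
  have hsm : StrictMono (key ∘ π) :=
    (Tuple.monotone_sort key).strictMono_of_injective (hkeyinj.comp π.injective)
  have hg : Monotone fun i => φ (b (π i), a (π i)) := by
    refine monotone_iff_forall_lt.2 fun i j hij => ?_
    have := key_lt.1 (hsm hij)
    rw [Prod.Lex.toLex_le_toLex', OrderDual.toDual_le_toDual]
    exact ⟨this.1, fun h => (this.2 h).1⟩
  have hgf : f = fun i => φ (b (π i), a (π i)) := by
    refine eq_of_monotone_of_map_univ_eq hf hg ?_
    have h1 : Finset.univ.val.map (fun i => (b (π i), a (π i))) = P := by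
      have h2 : (Finset.univ.val : Multiset (Fin n)).map π = Finset.univ.val := by
        exact congrArg Finset.val (Finset.map_univ_equiv π)
      conv_rhs => rw [← hP, ← habP, ← h2]
      rw [Multiset.map_map, Multiset.map_map]
      rfl
    rw [hfP, ← h1, Multiset.map_map]
    rfl
  have h1 (i : Fin n) : a i = b (π i) := congrArg (fun x => (ofLex x).1) (congrFun hgf i)
  have h2 (i : Fin n) : b i = a (π i) :=
    congrArg (fun x => OrderDual.ofDual (ofLex x).2) (congrFun hgf i)
  have hab (i : Fin n) : a (π⁻¹ i) = b i := by rw [h1]; simp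
  have hba (i : Fin n) : b (π⁻¹ i) = a i := by rw [h2]; simp
  have hlex (i j : Fin n) (hij : i < j) : a i ≤ a j ∧ (a i = a j → b j ≤ b i) := by
    have := hf hij.le
    rwa [hfab, hfab, Prod.Lex.toLex_le_toLex', OrderDual.toDual_le_toDual] at this
  have hcomp : IsCompatible π⁻¹ a := by
    rw [isCompatible_iff]
    intro i j hij
    refine ⟨(hlex i j hij).1, fun he => hsm.lt_iff_lt.1 ?_⟩
    have hππ (i : Fin n) : π (π⁻¹ i) = i := π.apply_symm_apply i
    simp only [Function.comp_apply, hππ]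
    exact key_lt.2 ⟨(hlex i j hij).2 he, fun _ => ⟨he.le, fun _ => hij⟩⟩
  refine ⟨π⁻¹, a, mul_eq_one_of_isCompatible hcomp hcomp hab hab hba hba, hcomp, ?_⟩
  rw [pairs]
  simpa only [hab] using habP

/-! ### The signed count -/

theorem card_fixedValues_add {n N : ℕ} {σ : Equiv.Perm (Fin n)} {a : Fin n → Fin N}
    (hσ : σ * σ = 1) (h : IsCompatible σ a) :
    (fixedValues σ a).card + 2 * (cycleValues σ a).card = n := by
  rw [← card_symmetrize, symmetrize_fixedValues_cycleValues hσ h, pairs, Multiset.card_map,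
    Finset.card_val, Finset.card_fin]

theorem card_isCompatible_of_card_cycles {n N k : ℕ} (hk : 2 * k ≤ n) :
    (((involutions n) ×ˢ (Finset.univ : Finset (Fin n → Fin N))).filter fun x =>
      IsCompatible x.1 x.2 ∧ (Finset.univ.filter fun i => i < x.1 i).card = k).card =
    N.choose (n - 2 * k) * ((N + 1).choose 2).multichoose k := by
  have hcard : ((Finset.powersetCard (n - 2 * k) (Finset.univ : Finset (Fin N))) ×ˢ
      (Finset.univ : Finset (Sym (Sym2 (Fin N)) k))).card =
      N.choose (n - 2 * k) * ((N + 1).choose 2).multichoose k := by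
    rw [Finset.card_product, Finset.card_powersetCard, Finset.card_fin, Finset.card_univ,
      Sym.card_sym_eq_multichoose, Sym2.card, Fintype.card_fin]
  have hcyc {x : Equiv.Perm (Fin n) × (Fin n → Fin N)} :
      (cycleValues x.1 x.2).card = (Finset.univ.filter fun i => i < x.1 i).card :=
    Multiset.card_map _ _
  rw [← hcard]
  have hmem {x : Equiv.Perm (Fin n) × (Fin n → Fin N)} (hx : x ∈ ((involutions n) ×ˢ
      (Finset.univ : Finset (Fin n → Fin N))).filter fun x => IsCompatible x.1 x.2 ∧
        (Finset.univ.filter fun i => i < x.1 i).card = k) :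
      x.1 * x.1 = 1 ∧ IsCompatible x.1 x.2 ∧ (cycleValues x.1 x.2).card = k := by
    rw [hcyc]
    simpa [involutions] using hx
  refine Finset.card_bij (fun x hx => (fixedValues x.1 x.2, Sym.mk _ (hmem hx).2.2)) ?_ ?_ ?_
  · intro x hx
    obtain ⟨h1, h2, h3⟩ := hmem hx
    have := card_fixedValues_add h1 h2
    simp only [Finset.mem_product, Finset.mem_powersetCard, Finset.subset_univ, Finset.mem_univ,
      true_and, and_true]
    omega
  · rintro ⟨σ, a⟩ hx ⟨σ', a'⟩ hy hxy
    obtain ⟨h1, h2, -⟩ := hmem hx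
    obtain ⟨h1', h2', -⟩ := hmem hy
    have e1 := congrArg Prod.fst hxy
    have e2 := congrArg (fun z : Finset (Fin N) × Sym (Sym2 (Fin N)) k =>
      (z.2 : Multiset (Sym2 (Fin N)))) hxy
    have hp := symmetrize_fixedValues_cycleValues h1 h2
    have hp' := symmetrize_fixedValues_cycleValues h1' h2'
    dsimp only at e1 h1 h2 h1' h2' hp hp'
    change cycleValues σ a = cycleValues σ' a' at e2
    rw [e1, e2, hp'] at hp
    obtain ⟨rfl, rfl⟩ := pairs_injective h1 h1' h2 h2' hp.symm
    rfl
  · rintro ⟨S, M⟩ hSM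
    simp only [Finset.mem_product, Finset.mem_powersetCard, Finset.subset_univ, Finset.mem_univ,
      true_and, and_true] at hSM
    obtain ⟨σ, a, h1, h2, h3⟩ := exists_pairs_eq (n := n) (symmetrize S (M : Multiset _))
      (map_swap_symmetrize _ _) (by rw [card_symmetrize, hSM, Sym.card_coe]; omega)
    rw [← symmetrize_fixedValues_cycleValues h1 h2] at h3
    obtain ⟨e1, e2⟩ := symmetrize_injective h3
    refine ⟨(σ, a), ?_, Prod.ext e1 (Sym.coe_injective e2)⟩
    have hc := hcyc (x := (σ, a))
    rw [e2, Sym.card_coe] at hc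
    simp [involutions, h1, h2, ← hc]

theorem sum_sign_mul_card_isCompatible (n N : ℕ) :
    ∑ σ ∈ involutions n, ((Equiv.Perm.sign σ : ℤˣ) : ℤ) *
      ((Finset.univ.filter fun a : Fin n → Fin N => IsCompatible σ a).card : ℤ) =
    ∑ k ∈ Finset.range (n / 2 + 1), (-1) ^ k *
      ((N.choose (n - 2 * k) * ((N + 1).choose 2).multichoose k : ℕ) : ℤ) := by
  set X := ((involutions n) ×ˢ (Finset.univ : Finset (Fin n → Fin N))).filter fun x =>
    IsCompatible x.1 x.2 with hX
  have hl : ∑ σ ∈ involutions n, ((Equiv.Perm.sign σ : ℤˣ) : ℤ) *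
      ((Finset.univ.filter fun a : Fin n → Fin N => IsCompatible σ a).card : ℤ) =
      ∑ x ∈ X, (-1 : ℤ) ^ (Finset.univ.filter fun i => i < x.1 i).card := by
    rw [hX, Finset.sum_filter, Finset.sum_product]
    refine Finset.sum_congr rfl fun σ hσ => ?_
    rw [← Finset.sum_filter]
    rw [Finset.sum_eq_card_nsmul
      (b := (-1 : ℤ) ^ (Finset.univ.filter fun i => i < σ i).card) fun _ _ => rfl,
      nsmul_eq_mul, mul_comm, sign_eq_neg_one_pow_card (Finset.mem_filter.1 hσ).2]
    simp
  have hmaps : ∀ x ∈ X, (Finset.univ.filter fun i => i < x.1 i).card ∈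
      Finset.range (n / 2 + 1) := by
    intro x hx
    simp only [hX, Finset.mem_filter, Finset.mem_product, involutions, Finset.mem_univ,
      true_and, and_true] at hx
    have := card_fixedValues_add hx.1 hx.2
    rw [cycleValues, Multiset.card_map, Finset.card_val] at this
    rw [Finset.mem_range]
    omega
  rw [hl, ← Finset.sum_fiberwise_of_maps_to hmaps]
  refine Finset.sum_congr rfl fun k hk => ?_
  rw [Finset.mem_range] at hk
  rw [← card_isCompatible_of_card_cycles (by omega), ← Finset.filter_filter, ← hX,
    Finset.sum_congr rfl fun x hx => by rw [(Finset.mem_filter.1 hx).2], Finset.sum_const,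
    nsmul_eq_mul, mul_comm]

end SignedEulerian

theorem theorem4 :
    Summable SignedEulerian.lhsTerm ∧ Summable SignedEulerian.rhsTerm ∧
      ∑' n : ℕ, SignedEulerian.lhsTerm n = ∑' m : ℕ, SignedEulerian.rhsTerm m := by
  -- The common value of both sums: the signed count with `N = d 0 + 1` and `n = d 1`.
  set G : SignedEulerian.Series := fun d => ∑ k ∈ Finset.range (d 1 / 2 + 1), (-1) ^ k *
      (((d 0 + 1).choose (d 1 - 2 * k) * ((d 0 + 2).choose 2).multichoose k : ℕ) : ℤ)
  have hr : HasSum SignedEulerian.rhsTerm G := SignedEulerian.hasSum_rhsTerm fun _ => rfl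
  have hl : HasSum SignedEulerian.lhsTerm G := by
    refine SignedEulerian.hasSum_lhsTerm fun d => ?_
    refine (SignedEulerian.sum_sign_mul_card_isCompatible (d 1) (d 0 + 1)).symm.trans ?_
    simp only [SignedEulerian.card_isCompatible, Nat.cast_ite, Nat.cast_zero]
  exact ⟨hl.summable, hr.summable, hl.tsum_eq.trans hr.tsum_eq.symm⟩
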